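/- Let $V$ be a finite set. A family $(A_v)_{v\in V}$ of binary observables on $\mathbb{C}^d$ ($d\ge 1$) consists of Hermitian $d\times d$ matrices with $A_v^2=\mathbb{1}$. It \emph{realises} a simple graph $G$ on $V$ (has $G$ as its anti-commutativity graph) if $A_vA_w=-A_wA_v$ exactly when $v,w$ are adjacent in $G$, and $A_vA_w=A_wA_v$ whenever they are not adjacent. For $\eta\in[0,1]$ put $$A_v^\eta=\eta A_v+\tfrac{\operatorname{tr}A_v}{d}(1-\eta)\mathbb{1},\qquad \mathsf{M}_v^\eta(\pm1)=\tfrac12(\mathbb{1}\pm A_v^\eta).$$ The family $(A^\eta_v)_{v\in V}$ is \emph{jointly measurable} if there are positive semidefinite matrices $\mathsf{E}(a)$, $a\in\{\pm1\}^V$, with $\sum_a\mathsf{E}(a)=\mathbb{1}$ and $\mathsf{M}_v^\eta(x)=\sum_{a:\,a_v=x}\mathsf{E}(a)$ for all $v\in V$, $x\in\{\pm1\}$. The \emph{incompatibility robustness} $\eta(G)$ is the supremum of all $\eta\in[0,1]$ for which $(A_v^\eta)_{v\in V}$ is jointly measurable for some family $(A_v)_{v\in V}$ realising $G$. Let $s\ge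 r\ge 1$ be integers and let $K_r\square K_s$ be the $r\times s$ rook's graph, the Cartesian product of the complete graphs $K_r$ and $K_s$. Then $K_r\square K_s$ is realised by some family of binary observables; for every family $(A_v)$ realising it, $\eta(K_r\square K_s)$ is the maximum of the set of $\eta\in[0,1]$ for which $(A_v^\eta)$ is jointly measurable; and $$\eta(K_r\square K_s)\le\frac{1}{\sqrt{s}},$$ with equality if and only if there exists an $r\times s$ partial Hadamard matrix, i.e. a matrix $C\in\{\pm1\}^{r\times s}$ with $CC^{\top}=s\,\mathbb{1}_r$. -/

import Mathlib

open scoped ComplexOrder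

/-- A positive operator-valued measure on `ℂ^d` with finite outcome set `Ω`: positive semidefinite
effects that sum to the identity. -/
structure POVM (d : ℕ) (Ω : Type*) [Fintype Ω] where
  effect : Ω → Matrix (Fin d) (Fin d) ℂ
  posSemidef : ∀ a, (effect a).PosSemidef
  sum_eq_one : ∑ a, effect a = 1

/-- A family of operator-valued functions `M v` (all with outcome set `Ω`) is jointly measurable
if there is a parent POVM `E` with outcomes `a : V → Ω` such that each `M v` is the `v`-th marginal
of `E`.  (The `M v` are then automatically POVMs.) -/
def JointlyMeasurable {d : ℕ} {V Ω : Type*} [Fintype V] [DecidableEq V] [Fintype Ω]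
    [DecidableEq Ω] (M : V → Ω → Matrix (Fin d) (Fin d) ℂ) : Prop :=
  ∃ E : POVM d (V → Ω), ∀ v x, M v x = ∑ a : V → Ω with a v = x, E.effect a

/-- A binary observable on `ℂ^d`: a Hermitian matrix whose square is the identity. -/
def IsBinaryObservable {d : ℕ} (A : Matrix (Fin d) (Fin d) ℂ) : Prop :=
  A.IsHermitian ∧ A * A = 1

/-- `A` is a family of binary observables whose anti-commutativity graph is `G`: adjacent vertices
are exactly the pairs of anti-commuting observables, non-adjacent ones commute. -/
structure IsRealisation {d : ℕ} {V : Type*} (G : SimpleGraph V)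
    (A : V → Matrix (Fin d) (Fin d) ℂ) : Prop where
  binary : ∀ v, IsBinaryObservable (A v)
  adj_iff : ∀ v w, G.Adj v w ↔ A v * A w = -(A w * A v)
  commute : ∀ v w, ¬ G.Adj v w → A v * A w = A w * A v

/-- The noisy observable `η A + (1 - η) (tr A / d) 1`. -/
noncomputable def noisyObservable {d : ℕ} (η : ℝ) (A : Matrix (Fin d) (Fin d) ℂ) :
    Matrix (Fin d) (Fin d) ℂ :=
  (η : ℂ) • A + ((A.trace / (d : ℂ)) * (1 - (η : ℂ))) • 1

/-- The effects `(1 ± B) / 2` of the two-outcome measurement of `B`; the outcome set `{1, -1}`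
is `ℤˣ`. -/
noncomputable def binaryEffect {d : ℕ} (B : Matrix (Fin d) (Fin d) ℂ) (x : ℤˣ) :
    Matrix (Fin d) (Fin d) ℂ :=
  (1 / 2 : ℂ) • (1 + ((x : ℤ) : ℂ) • B)

/-- The `η ∈ [0, 1]` for which the noisy versions of the observables `A v` are jointly
measurable. -/
def compatibleNoise {d : ℕ} {V : Type*} [Fintype V] [DecidableEq V]
    (A : V → Matrix (Fin d) (Fin d) ℂ) : Set ℝ :=
  {η | η ∈ Set.Icc (0 : ℝ) 1 ∧
    JointlyMeasurable (fun v => binaryEffect (noisyObservable η (A v)))}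

/-- The incompatibility robustness `η(G)`: the largest `η ∈ [0, 1]` such that the noisy versions of
observables with anti-commutativity graph `G` are jointly measurable.  (That this is a maximum and
is the same for every realisation of `G` is not built into the definition.) -/
noncomputable def incompatibilityRobustness {V : Type*} [Fintype V] [DecidableEq V]
    (G : SimpleGraph V) : ℝ :=
  sSup {η | ∃ d : ℕ, 0 < d ∧ ∃ A : V → Matrix (Fin d) (Fin d) ℂ,
    IsRealisation G A ∧ η ∈ compatibleNoise A}

/-- The rook's graph `K_r □ K_s`. -/
def rookGraph (r s : ℕ) : SimpleGraph (Fin r × Fin s) :=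
  SimpleGraph.boxProd (⊤ : SimpleGraph (Fin r)) (⊤ : SimpleGraph (Fin s))

/-- An `r × s` partial Hadamard matrix: entries `±1` and pairwise orthogonal rows. -/
def IsPartialHadamard {r s : ℕ} (C : Matrix (Fin r) (Fin s) ℝ) : Prop :=
  (∀ i j, C i j = 1 ∨ C i j = -1) ∧ C * C.transpose = (s : ℝ) • 1

open Matrix

/-! Two reductions turn the problem into one about a single convenient realisation. First, when
every vertex has a neighbour, all observables are traceless, and a parent POVM for one realisation
can be converted into one for any other (`IsParent.transfer`): the operators `(A v)ᵀ ⊗ B v` commute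
pairwise, since the signs from the two factors cancel, and their joint measurement links the two
systems. Compactness of the set of POVMs then makes the supremum a maximum.

Second, the rook's graph is realised by `i c_k d_l` with all `c_k`, `d_l` pairwise anticommuting. A
real combination `R_i(b) = ∑ j, b_j A_ij` along a row satisfies `R_i(b)² = |b|²`, and `[R_i(b),
R_k(b')] = 2⟨b, b'⟩ c_i c_k` for `i ≠ k`. For a sign pattern `a` this gives `R_i(a_i) ≤ √s`; tracing
`√s - R_i(a_i)` against a parent POVM and summing over `a` yields the bound (`sum_rowGap_trace`).

In the equality case all these nonnegative traces vanish, so any nonzero effect `E a` satisfies `E a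
* R_i = √s • E a` for every `i`. The commutators are then annihilated by `E a`, which forces the
rows of `a` to be orthogonal. Conversely, the rows of a partial Hadamard matrix, with column signs
flipped at random, give commuting row observables; measuring these jointly attains the bound
(`IsPartialHadamard.exists_isParent`). -/

theorem unitsInt_cast_mul_self (u : ℤˣ) : ((u : ℤ) : ℂ) * ((u : ℤ) : ℂ) = 1 := by
  rcases Int.units_eq_one_or u with rfl | rfl <;> simp

theorem unitsInt_sum {M : Type*} [AddCommMonoid M] (f : ℤˣ → M) : ∑ u, f u = f 1 + f (-1) := by
  rw [show (Finset.univ : Finset ℤˣ) = {1, -1} from rfl, Finset.sum_pair (by decide)]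

/-- A Hermitian idempotent matrix is positive semidefinite. -/
theorem posSemidef_of_isHermitian_of_mul_self {n : Type*} [Fintype n] {P : Matrix n n ℂ}
    (h : P.IsHermitian) (hP : P * P = P) : P.PosSemidef := by
  have := posSemidef_conjTranspose_mul_self P
  rwa [h.eq, hP] at this

open scoped IsMulCommutative in
/-- Pairwise commuting Hermitian involutions admit a joint measurement. -/
theorem exists_joint_of_commute {V n : Type*} [Fintype V] [DecidableEq V] [Fintype n]
    [DecidableEq n] (X : V → Matrix n n ℂ) (hH : ∀ v, (X v).IsHermitian)
    (hX : ∀ v, X v * X v = 1) (hcomm : ∀ v w, X v * X w = X w * X v) :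
    ∃ Q : (V → ℤˣ) → Matrix n n ℂ, (∀ e, (Q e).PosSemidef) ∧ ∑ e, Q e = 1 ∧
      ∀ v, ∑ e, ((e v : ℤ) : ℂ) • Q e = X v := by
  -- Inside the commutative subalgebra generated by the `X v`, the spectral projections of all the
  -- involutions can be multiplied with `∏`, independently of order.
  have hc : IsMulCommutative (Algebra.adjoin ℂ (Set.range X)) := by
    apply Algebra.isMulCommutative_adjoin
    rintro _ ⟨v, rfl⟩ _ ⟨w, rfl⟩
    exact hcomm v w
  let x : V → Algebra.adjoin ℂ (Set.range X) := fun v =>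
    ⟨X v, Algebra.subset_adjoin (Set.mem_range_self v)⟩
  have hx : ∀ v, x v * x v = 1 := fun v => Subtype.ext (hX v)
  let p : V → ℤˣ → Algebra.adjoin ℂ (Set.range X) := fun v u =>
    (1 / 2 : ℂ) • (1 + ((u : ℤ) : ℂ) • x v)
  have hxp : ∀ v u, x v * p v u = ((u : ℤ) : ℂ) • p v u := by
    intro v u
    simp only [p, mul_smul_comm, mul_add, hx, smul_add, smul_smul, mul_one]
    rw [show ((u : ℤ) : ℂ) * (1 / 2 * ((u : ℤ) : ℂ)) = 1 / 2 by
      rw [mul_left_comm, unitsInt_cast_mul_self, mul_one], mul_comm ((u : ℤ) : ℂ) (1 / 2), add_comm]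
  have hpp : ∀ v u, p v u * p v u = p v u := by
    intro v u
    have h : p v u * p v u = (1 / 2 : ℂ) • (p v u + ((u : ℤ) : ℂ) • (x v * p v u)) := by
      conv_lhs => lhs; simp only [p]
      rw [smul_mul_assoc, add_mul, one_mul, smul_mul_assoc]
    rw [h, hxp, smul_smul, unitsInt_cast_mul_self, one_smul, ← two_smul ℂ, smul_smul]
    norm_num
  have hps : ∀ v, ∑ u, p v u = 1 := by
    intro v
    rw [unitsInt_sum]
    simp only [p, ← smul_add]
    rw [show (1 + (((1 : ℤˣ) : ℤ) : ℂ) • x v + (1 + (((-1 : ℤˣ) : ℤ) : ℂ) • x v)) = (2 : ℂ) • 1 by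
      simp [two_smul]; abel]
    rw [smul_smul]; norm_num
  let q : (V → ℤˣ) → Algebra.adjoin ℂ (Set.range X) := fun e => ∏ v, p v (e v)
  have hq1 : ∑ e, q e = 1 := by
    rw [← Fintype.prod_sum]
    exact Finset.prod_eq_one fun v _ => hps v
  have hxq : ∀ v e, x v * q e = ((e v : ℤ) : ℂ) • q e := by
    intro v e
    simp only [q]
    rw [← Finset.mul_prod_erase _ _ (Finset.mem_univ v), ← mul_assoc, hxp, smul_mul_assoc]
  refine ⟨fun e => (q e : Matrix n n ℂ), fun e => ?_, ?_, fun v => ?_⟩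
  · apply posSemidef_of_isHermitian_of_mul_self
    · apply Finset.prod_induction (fun v => p v (e v))
        (fun y => (y : Matrix n n ℂ).IsHermitian)
      · intro a b ha hb
        have : (a : Matrix n n ℂ) * b = b * a := congrArg Subtype.val (mul_comm a b)
        rw [IsHermitian, MulMemClass.coe_mul, conjTranspose_mul, ha.eq, hb.eq, this]
      · exact isHermitian_one
      · intro v _
        simp [p, x, IsHermitian, conjTranspose_smul, (hH v).eq]
    · rw [← MulMemClass.coe_mul, ← Finset.prod_mul_distrib]
      simp only [hpp, q]
  · rw [← AddSubmonoidClass.coe_finsetSum, hq1]; rfl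
  · have : ∑ e, ((e v : ℤ) : ℂ) • q e = x v := by
      simp_rw [← hxq]
      rw [← Finset.mul_sum, hq1, mul_one]
    have := congrArg (Subtype.val) this
    rw [AddSubmonoidClass.coe_finsetSum] at this
    exact this

/-! ### Contraction of a tensor factor. -/

open scoped MatrixOrder in
theorem Matrix.PosSemidef.exists_eq_conjTranspose_mul_self {n : Type*} [Fintype n]
    {P : Matrix n n ℂ} (hP : P.PosSemidef) : ∃ X : Matrix n n ℂ, P = Xᴴ * X := by
  classical
  exact CStarAlgebra.nonneg_iff_eq_star_mul_self.mp hP.nonneg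

/-- Contract the first tensor factor of `Q` with `P`. -/
def slice {m n : Type*} [Fintype m] (P : Matrix m m ℂ) (Q : Matrix (m × n) (m × n) ℂ) :
    Matrix n n ℂ :=
  fun k l => ∑ i, ∑ j, P i j * Q (i, k) (j, l)

section slice

variable {m n : Type*} [Fintype m]

theorem slice_sum_left {ι : Type*} (s : Finset ι) (P : ι → Matrix m m ℂ)
    (Q : Matrix (m × n) (m × n) ℂ) : slice (∑ a ∈ s, P a) Q = ∑ a ∈ s, slice (P a) Q := by
  ext k l
  simp only [slice, Matrix.sum_apply, Finset.sum_mul]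
  conv_rhs => rw [Finset.sum_comm]
  exact Finset.sum_congr rfl fun i _ => Finset.sum_comm

theorem slice_sum_right {ι : Type*} (s : Finset ι) (P : Matrix m m ℂ)
    (Q : ι → Matrix (m × n) (m × n) ℂ) : slice P (∑ a ∈ s, Q a) = ∑ a ∈ s, slice P (Q a) := by
  ext k l
  simp only [slice, Matrix.sum_apply, Finset.mul_sum]
  conv_rhs => rw [Finset.sum_comm]
  exact Finset.sum_congr rfl fun i _ => Finset.sum_comm

theorem slice_smul_left (c : ℂ) (P : Matrix m m ℂ) (Q : Matrix (m × n) (m × n) ℂ) :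
    slice (c • P) Q = c • slice P Q := by
  ext k l
  simp [slice, Finset.mul_sum, mul_assoc]

theorem slice_smul_right (c : ℂ) (P : Matrix m m ℂ) (Q : Matrix (m × n) (m × n) ℂ) :
    slice P (c • Q) = c • slice P Q := by
  ext k l
  simp [slice, Finset.mul_sum, mul_left_comm]

open scoped Kronecker in
theorem slice_kronecker (P A : Matrix m m ℂ) (B : Matrix n n ℂ) :
    slice P (Aᵀ ⊗ₖ B) = (P * A).trace • B := by
  ext k l
  simp [slice, trace, mul_apply, Finset.sum_mul, mul_assoc]

theorem slice_posSemidef [Fintype n] [DecidableEq n] {P : Matrix m m ℂ}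
    {Q : Matrix (m × n) (m × n) ℂ}
    (hP : P.PosSemidef) (hQ : Q.PosSemidef) : (slice P Q).PosSemidef := by
  classical
  obtain ⟨X, rfl⟩ := hP.exists_eq_conjTranspose_mul_self
  -- `W t` tensors a vector of the second factor with row `t` of `X`, so the contraction becomes a
  -- sum of congruences of `Q`.
  let W : m → Matrix (m × n) n ℂ := fun t => of fun il l => if il.2 = l then X t il.1 else 0
  have : slice (Xᴴ * X) Q = ∑ t, (W t)ᴴ * Q * W t := by
    ext k l
    simp only [slice, W, mul_apply, Matrix.sum_apply, conjTranspose_apply,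
      of_apply, Fintype.sum_prod_type, Finset.sum_mul, apply_ite (star : ℂ → ℂ), star_zero, ite_mul,
      zero_mul, mul_ite, mul_zero, Finset.sum_ite_eq', Finset.mem_univ, if_true]
    conv_rhs =>
      rw [Finset.sum_congr rfl fun _ _ => Finset.sum_comm, Finset.sum_comm,
        Finset.sum_congr rfl fun _ _ => Finset.sum_comm]
    exact Finset.sum_congr rfl fun _ _ => Finset.sum_congr rfl fun _ _ =>
      Finset.sum_congr rfl fun _ _ => mul_right_comm _ _ _
  rw [this]
  exact posSemidef_sum _ fun t _ => hQ.conjTranspose_mul_mul_same _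

end slice

/-! ### Parent measurements and independence of the realisation. -/

/-- `E` measures the family `η • A` of unbiased observables jointly. -/
def IsParent {d : ℕ} {V : Type*} [Fintype V] [DecidableEq V]
    (A : V → Matrix (Fin d) (Fin d) ℂ) (η : ℝ) (E : (V → ℤˣ) → Matrix (Fin d) (Fin d) ℂ) : Prop :=
  (∀ a, (E a).PosSemidef) ∧ ∑ a, E a = 1 ∧ ∀ v, ∑ a, ((a v : ℤ) : ℂ) • E a = (η : ℂ) • A v

section

variable {d : ℕ} {V : Type*} [Fintype V] [DecidableEq V]

/-- A two-outcome marginal is determined by its total and its signed sum, because the indicator of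
`a v = x` is `(1 + x * a v) / 2`. -/
theorem sum_filter_eq_binaryEffect_iff (E : (V → ℤˣ) → Matrix (Fin d) (Fin d) ℂ)
    (hE : ∑ a, E a = 1) (B : Matrix (Fin d) (Fin d) ℂ) (v : V) :
    (∀ x, binaryEffect B x = ∑ a : V → ℤˣ with a v = x, E a) ↔
      ∑ a, ((a v : ℤ) : ℂ) • E a = B := by
  constructor
  · intro h
    rw [← Finset.sum_fiberwise (s := Finset.univ) (g := fun a : V → ℤˣ => a v)]
    have : ∀ x : ℤˣ, ∑ a : V → ℤˣ with a v = x, ((a v : ℤ) : ℂ) • E a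
        = ((x : ℤ) : ℂ) • binaryEffect B x := by
      intro x
      rw [h, Finset.smul_sum]
      refine Finset.sum_congr rfl fun a ha => ?_
      rw [(Finset.mem_filter.mp ha).2]
    simp_rw [this]
    rw [unitsInt_sum]
    simp only [binaryEffect, Units.val_one, Units.val_neg, Int.cast_one, Int.cast_neg]
    module
  · intro h x
    have : ∀ a : V → ℤˣ, (if a v = x then E a else 0)
        = (1 / 2 : ℂ) • (E a + ((x : ℤ) : ℂ) • ((a v : ℤ) : ℂ) • E a) := by
      intro a
      rcases Int.units_eq_one_or x with rfl | rfl <;>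
        rcases Int.units_eq_one_or (a v) with h' | h' <;> simp [h'] <;> module
    rw [Finset.sum_filter]
    simp_rw [this]
    rw [← Finset.smul_sum, Finset.sum_add_distrib, ← Finset.smul_sum, hE, h, binaryEffect]

theorem jointlyMeasurable_binaryEffect_iff (B : V → Matrix (Fin d) (Fin d) ℂ) :
    JointlyMeasurable (fun v => binaryEffect (B v)) ↔
      ∃ E : (V → ℤˣ) → Matrix (Fin d) (Fin d) ℂ, (∀ a, (E a).PosSemidef) ∧ ∑ a, E a = 1 ∧
        ∀ v, ∑ a, ((a v : ℤ) : ℂ) • E a = B v := by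
  constructor
  · rintro ⟨E, h⟩
    exact ⟨E.effect, E.posSemidef, E.sum_eq_one, fun v =>
      (sum_filter_eq_binaryEffect_iff E.effect E.sum_eq_one _ v).mp (h v)⟩
  · rintro ⟨E, h1, h2, h3⟩
    exact ⟨⟨E, h1, h2⟩, fun v => (sum_filter_eq_binaryEffect_iff E h2 _ v).mpr (h3 v)⟩

theorem noisyObservable_of_trace_eq_zero (η : ℝ) {A : Matrix (Fin d) (Fin d) ℂ}
    (h : A.trace = 0) : noisyObservable η A = (η : ℂ) • A := by
  simp [noisyObservable, h]

theorem mem_compatibleNoise_iff {A : V → Matrix (Fin d) (Fin d) ℂ} (hA : ∀ v, (A v).trace = 0)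
    {η : ℝ} : η ∈ compatibleNoise A ↔ η ∈ Set.Icc (0 : ℝ) 1 ∧ ∃ E, IsParent A η E := by
  rw [compatibleNoise, Set.mem_ofPred_eq, jointlyMeasurable_binaryEffect_iff]
  simp only [noisyObservable_of_trace_eq_zero _ (hA _), IsParent]

theorem trace_eq_zero_of_anticommute {A B : Matrix (Fin d) (Fin d) ℂ} (hB : B * B = 1)
    (h : A * B = -(B * A)) : A.trace = 0 := by
  have h1 : A.trace = -A.trace := by
    calc A.trace = (A * B * B).trace := by rw [mul_assoc, hB, mul_one]
      _ = -(B * A * B).trace := by rw [h, neg_mul, trace_neg]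
      _ = -(B * (B * A)).trace := by rw [trace_mul_comm (B * A) B]
      _ = -A.trace := by rw [← mul_assoc, hB, one_mul]
  exact self_eq_neg.mp h1

open scoped Kronecker in
/-- Joint measurability of the noisy observables passes from one realisation to any other. -/
theorem IsParent.transfer {d' : ℕ} (hd : 0 < d) {G : SimpleGraph V}
    {A : V → Matrix (Fin d) (Fin d) ℂ} {B : V → Matrix (Fin d') (Fin d') ℂ}
    (hA : IsRealisation G A) (hB : IsRealisation G B) {η : ℝ}
    {E : (V → ℤˣ) → Matrix (Fin d) (Fin d) ℂ} (hE : IsParent A η E) : ∃ F, IsParent B η F := by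
  obtain ⟨Q, hQ, hQ1, hQX⟩ := exists_joint_of_commute (fun v => (A v)ᵀ ⊗ₖ B v)
    (fun v => by
      rw [IsHermitian, conjTranspose_kronecker, (hB.binary v).1.eq, ((hA.binary v).1.transpose).eq])
    (fun v => by
      rw [← mul_kronecker_mul, ← transpose_mul, (hA.binary v).2, (hB.binary v).2, transpose_one,
        one_kronecker_one])
    (fun v w => by
      rw [← mul_kronecker_mul, ← mul_kronecker_mul, ← transpose_mul, ← transpose_mul]
      by_cases h : G.Adj v w
      · rw [(hA.adj_iff v w).mp h, (hB.adj_iff v w).mp h]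
        ext ⟨i, k⟩ ⟨j, l⟩
        simp
      · rw [hA.commute v w h, hB.commute v w h])
  obtain ⟨hE0, hE1, hEA⟩ := hE
  have hd' : (d : ℂ) ≠ 0 := Nat.cast_ne_zero.mpr hd.ne'
  -- The new outcome is `b = e * a`, where `e` comes from the joint measurement `Q` and `a` from
  -- `E`, contracted on the first factor. The signs multiply, so the signed sum at `w` is `(1 / d) •
  -- slice (η A w) ((A w)ᵀ ⊗ B w)`, which is `η B w` because `tr (A w * A w) = d`.
  refine ⟨fun b => (1 / d : ℂ) • ∑ e, slice (E (e * b)) (Q e), fun b => ?_, ?_, fun w => ?_⟩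
  · refine PosSemidef.smul (posSemidef_sum _ fun e _ => slice_posSemidef (hE0 _) (hQ e)) ?_
    rw [one_div, ← Complex.ofReal_natCast, ← Complex.ofReal_inv]
    exact Complex.zero_le_real.mpr (by positivity)
  · rw [← Finset.smul_sum, Finset.sum_comm]
    have : ∀ e, ∑ b, slice (E (e * b)) (Q e) = slice 1 (Q e) := by
      intro e
      rw [← slice_sum_left, ← hE1]
      congr 1
      exact Fintype.sum_equiv (Equiv.mulLeft e) _ _ fun _ => rfl
    simp_rw [this]
    have h1 := slice_kronecker (1 : Matrix (Fin d) (Fin d) ℂ) 1 (1 : Matrix (Fin d') (Fin d') ℂ)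
    rw [transpose_one, one_kronecker_one] at h1
    rw [← slice_sum_right, hQ1, h1]
    simp [smul_smul, hd']
  · have hswap : ∑ b : V → ℤˣ, ((b w : ℤ) : ℂ) • (1 / d : ℂ) • ∑ e, slice (E (e * b)) (Q e)
        = (1 / d : ℂ) • ∑ e, ∑ b : V → ℤˣ, ((b w : ℤ) : ℂ) • slice (E (e * b)) (Q e) := by
      simp_rw [smul_comm _ (1 / d : ℂ)]
      rw [← Finset.smul_sum, Finset.sum_comm]
      simp_rw [Finset.smul_sum]
    have : ∀ e, ∑ b, ((b w : ℤ) : ℂ) • slice (E (e * b)) (Q e)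
        = slice ((η : ℂ) • A w) (((e w : ℤ) : ℂ) • Q e) := by
      intro e
      rw [← hEA w, slice_sum_left]
      refine Fintype.sum_equiv (Equiv.mulLeft e) _ _ fun b => ?_
      rw [slice_smul_left, slice_smul_right, smul_smul]
      change _ = ((((e w * b w : ℤˣ) : ℤ) : ℂ) * ((e w : ℤ) : ℂ)) • slice (E (e * b)) (Q e)
      rw [Units.val_mul, Int.cast_mul, mul_right_comm, unitsInt_cast_mul_self, one_mul]
    rw [hswap]
    simp_rw [this]
    rw [← slice_sum_right, hQX, slice_smul_left, slice_kronecker, (hA.binary w).2, trace_one,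
      Fintype.card_fin, smul_smul, smul_smul]
    congr 1
    field_simp

end

/-! ### Compactness and attainment of the robustness. -/

section

variable {d : ℕ} {V : Type*} [Fintype V] [DecidableEq V]

/-- Each entry is an inner product of two columns of `X`, bounded termwise by the
arithmetic-geometric mean inequality. Used to bound all entries of an effect through its diagonal.
-/
theorem Matrix.PosSemidef.norm_apply_le {P : Matrix (Fin d) (Fin d) ℂ} (hP : P.PosSemidef)
    (i j : Fin d) : ‖P i j‖ ≤ ((P i i).re + (P j j).re) / 2 := by
  obtain ⟨X, rfl⟩ := hP.exists_eq_conjTranspose_mul_self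
  have hdiag : ∀ i, ((Xᴴ * X) i i).re = ∑ k, ‖X k i‖ ^ 2 := by
    intro i
    rw [mul_apply, Complex.re_sum]
    refine Finset.sum_congr rfl fun k _ => ?_
    rw [conjTranspose_apply, Complex.star_def, ← Complex.normSq_eq_conj_mul_self,
      Complex.ofReal_re, Complex.normSq_eq_norm_sq]
  rw [hdiag, hdiag, ← Finset.sum_add_distrib, Finset.sum_div, mul_apply]
  refine (norm_sum_le _ _).trans (Finset.sum_le_sum fun k _ => ?_)
  rw [norm_mul, conjTranspose_apply, norm_star]
  nlinarith [sq_nonneg (‖X k i‖ - ‖X k j‖)]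

theorem isClosed_posSemidef : IsClosed {P : Matrix (Fin d) (Fin d) ℂ | P.PosSemidef} := by
  simp only [posSemidef_iff_dotProduct_mulVec, IsHermitian]
  rw [Set.ofPred_and]
  refine IsClosed.inter (isClosed_eq (by fun_prop) (by fun_prop)) ?_
  simp only [Set.ofPred_forall]
  refine isClosed_iInter fun x => ?_
  exact isClosed_Ici.preimage (f := fun P : Matrix (Fin d) (Fin d) ℂ => star x ⬝ᵥ P *ᵥ x)
    (by fun_prop)

theorem isCompact_povm {Ω : Type*} [Fintype Ω] :
    IsCompact {E : Ω → Matrix (Fin d) (Fin d) ℂ | (∀ a, (E a).PosSemidef) ∧ ∑ a, E a = 1} := by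
  have hK : IsCompact (Set.univ.pi fun _ : Ω => Set.univ.pi fun _ : Fin d =>
      Set.univ.pi fun _ : Fin d => Metric.closedBall (0 : ℂ) 1) :=
    isCompact_univ_pi fun _ => isCompact_univ_pi fun _ => isCompact_univ_pi fun _ =>
      isCompact_closedBall 0 1
  refine IsCompact.of_isClosed_subset hK ?_ ?_
  · rw [Set.ofPred_and]
    refine IsClosed.inter ?_ (isClosed_eq (by fun_prop) (by fun_prop))
    rw [Set.ofPred_forall]
    exact isClosed_iInter fun a => isClosed_posSemidef.preimage
      (f := fun E : Ω → Matrix (Fin d) (Fin d) ℂ => E a) (by fun_prop)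
  · rintro E ⟨h0, h1⟩ a - i - j -
    have hdiag : ∀ i, (E a i i).re ≤ 1 := by
      intro i
      have h2 := congrArg (fun M : Matrix (Fin d) (Fin d) ℂ => (M i i).re) h1
      simp only [Matrix.sum_apply, Complex.re_sum, one_apply_eq, Complex.one_re] at h2
      rw [← h2]
      exact Finset.single_le_sum (f := fun b => (E b i i).re)
        (fun b _ => (Complex.le_def.mp (h0 b).diag_nonneg).1) (Finset.mem_univ a)
    rw [mem_closedBall_zero_iff]
    exact ((h0 a).norm_apply_le i j).trans (by linarith [hdiag i, hdiag j])

/-- The set is the projection to `η` of a closed subset of the compact product of `[0, 1]` with the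
POVMs. -/
theorem isCompact_compatibleNoise (A : V → Matrix (Fin d) (Fin d) ℂ) :
    IsCompact (compatibleNoise A) := by
  have hK := (isCompact_Icc (a := (0 : ℝ)) (b := 1)).prod
    (isCompact_povm (d := d) (Ω := V → ℤˣ))
  have hC : IsClosed {p : ℝ × ((V → ℤˣ) → Matrix (Fin d) (Fin d) ℂ) |
      ∀ v, ∑ a, ((a v : ℤ) : ℂ) • p.2 a = noisyObservable p.1 (A v)} := by
    rw [Set.ofPred_forall]
    refine isClosed_iInter fun v => isClosed_eq (by fun_prop) ?_
    unfold noisyObservable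
    fun_prop
  have h := (hK.inter_right hC).image continuous_fst
  convert h using 1
  ext η
  rw [compatibleNoise, Set.mem_ofPred_eq, jointlyMeasurable_binaryEffect_iff]
  constructor
  · rintro ⟨h, E, h0, h1, h2⟩
    exact ⟨(η, E), ⟨⟨h, h0, h1⟩, h2⟩, rfl⟩
  · rintro ⟨⟨_, E⟩, ⟨⟨h, h0, h1⟩, h2⟩, rfl⟩
    exact ⟨h, E, h0, h1, h2⟩

theorem zero_mem_compatibleNoise {A : V → Matrix (Fin d) (Fin d) ℂ}
    (hA : ∀ v, (A v).trace = 0) : (0 : ℝ) ∈ compatibleNoise A := by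
  obtain ⟨Q, hQ⟩ := exists_joint_of_commute (fun _ : V => (1 : Matrix (Fin d) (Fin d) ℂ))
    (fun _ => isHermitian_one) (fun _ => mul_one _) (fun _ _ => rfl)
  rw [mem_compatibleNoise_iff hA]
  -- Averaging any POVM with its image under `a ↦ -a` makes every signed marginal vanish.
  refine ⟨by simp, fun a => (1 / 2 : ℂ) • (Q a + Q (-a)), fun a => ?_, ?_, fun v => ?_⟩
  · refine ((hQ.1 a).add (hQ.1 (-a))).smul ?_
    rw [Complex.le_def]; norm_num
  · rw [← Finset.smul_sum, Finset.sum_add_distrib,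
      Fintype.sum_equiv (Equiv.neg (V → ℤˣ)) (fun a => Q (-a)) Q fun _ => rfl, hQ.2.1]
    module
  · have : ∑ a : V → ℤˣ, ((a v : ℤ) : ℂ) • Q (-a) = -∑ a : V → ℤˣ, ((a v : ℤ) : ℂ) • Q a := by
      rw [← Finset.sum_neg_distrib]
      exact Fintype.sum_equiv (Equiv.neg (V → ℤˣ)) _ _ fun a => by simp
    simp_rw [smul_comm _ (1 / 2 : ℂ), smul_add]
    rw [Finset.sum_add_distrib, ← Finset.smul_sum, ← Finset.smul_sum, this]
    simp

variable {G : SimpleGraph V}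

omit [Fintype V] [DecidableEq V] in
theorem IsRealisation.trace_eq_zero {A : V → Matrix (Fin d) (Fin d) ℂ} (hA : IsRealisation G A)
    (hG : ∀ v, ∃ w, G.Adj v w) (v : V) : (A v).trace = 0 := by
  obtain ⟨w, hw⟩ := hG v
  exact trace_eq_zero_of_anticommute (hA.binary w).2 ((hA.adj_iff v w).mp hw)

theorem compatibleNoise_subset (hG : ∀ v, ∃ w, G.Adj v w) {d' : ℕ} (hd : 0 < d)
    {A : V → Matrix (Fin d) (Fin d) ℂ} {B : V → Matrix (Fin d') (Fin d') ℂ}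
    (hA : IsRealisation G A) (hB : IsRealisation G B) : compatibleNoise A ⊆ compatibleNoise B := by
  intro η h
  rw [mem_compatibleNoise_iff (hA.trace_eq_zero hG)] at h
  rw [mem_compatibleNoise_iff (hB.trace_eq_zero hG)]
  obtain ⟨h, E, hE⟩ := h
  exact ⟨h, hE.transfer hd hA hB⟩

theorem isGreatest_incompatibilityRobustness (hG : ∀ v, ∃ w, G.Adj v w) (hd : 0 < d)
    {A : V → Matrix (Fin d) (Fin d) ℂ} (hA : IsRealisation G A) :
    IsGreatest (compatibleNoise A) (incompatibilityRobustness G) := by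
  have : incompatibilityRobustness G = sSup (compatibleNoise A) := by
    unfold incompatibilityRobustness
    congr 1
    ext η
    constructor
    · rintro ⟨d', hd', B, hB, h⟩
      exact compatibleNoise_subset hG hd' hB hA h
    · exact fun h => ⟨d, hd, A, hA, h⟩
  rw [this]
  exact (isCompact_compatibleNoise A).isGreatest_sSup
    ⟨0, zero_mem_compatibleNoise (hA.trace_eq_zero hG)⟩

end

/-! ### Anticommuting families and the rook's graph realisation. -/

/-- Pairwise anticommuting Hermitian involutions. -/
structure IsClifford {κ n : Type*} [Fintype n] [DecidableEq n] (γ : κ → Matrix n n ℂ) : Prop where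
  isHermitian : ∀ k, (γ k).IsHermitian
  mul_self : ∀ k, γ k * γ k = 1
  anticommute : ∀ k l, k ≠ l → γ k * γ l = -(γ l * γ k)

theorem IsClifford.submatrix {κ m n : Type*} [Fintype m] [DecidableEq m] [Fintype n]
    [DecidableEq n] {γ : κ → Matrix n n ℂ} (h : IsClifford γ) (e : m ≃ n) :
    IsClifford fun k => (γ k).submatrix e e where
  isHermitian k := (h.isHermitian k).submatrix e
  mul_self k := by rw [submatrix_mul_equiv, h.mul_self, submatrix_one_equiv]
  anticommute k l hkl := by
    rw [submatrix_mul_equiv, submatrix_mul_equiv, h.anticommute k l hkl, submatrix_neg]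
    rfl

theorem exists_isClifford (n : ℕ) :
    ∃ d : ℕ, 0 < d ∧ ∃ γ : Fin n → Matrix (Fin d) (Fin d) ℂ, IsClifford γ := by
  induction n with
  | zero => exact ⟨1, one_pos, Fin.elim0, fun k => k.elim0, fun k => k.elim0, fun k => k.elim0⟩
  | succ n ih =>
    obtain ⟨d, hd, γ, h⟩ := ih
    -- The doubling step of the Jordan–Wigner construction: `σ_z ⊗ 1` is added and each old `γ k`
    -- becomes `σ_x ⊗ γ k`.
    have key : IsClifford (Fin.cons (fromBlocks 1 0 0 (-1)) fun k => fromBlocks 0 (γ k) (γ k) 0 :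
        Fin (n + 1) → Matrix (Fin d ⊕ Fin d) (Fin d ⊕ Fin d) ℂ) := by
      refine ⟨fun k => ?_, fun k => ?_, fun k l hkl => ?_⟩
      · refine Fin.cases ?_ (fun k => ?_) k
        · simp [IsHermitian, fromBlocks_conjTranspose]
        · simp [IsHermitian, fromBlocks_conjTranspose, (h.isHermitian k).eq]
      · refine Fin.cases ?_ (fun k => ?_) k
        · simp [fromBlocks_multiply]
        · simp [fromBlocks_multiply, h.mul_self]
      · induction k using Fin.cases with
        | zero =>
          induction l using Fin.cases with
          | zero => exact absurd rfl hkl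
          | succ l => simp [fromBlocks_multiply, fromBlocks_neg]
        | succ k =>
          induction l using Fin.cases with
          | zero => simp [fromBlocks_multiply, fromBlocks_neg]
          | succ l =>
            have := h.anticommute k l fun h' => hkl (by rw [h'])
            simp [fromBlocks_multiply, fromBlocks_neg, this]
    exact ⟨d + d, by omega, _, key.submatrix finSumFinEquiv.symm⟩

section

variable {r s d : ℕ}

/-- The rook's graph observables `i c_k d_l` built from anticommuting `c_k` and `d_l`. -/
noncomputable def rookObservable (γ : Fin r ⊕ Fin s → Matrix (Fin d) (Fin d) ℂ)
    (p : Fin r × Fin s) : Matrix (Fin d) (Fin d) ℂ :=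
  Complex.I • (γ (.inl p.1) * γ (.inr p.2))

variable {γ : Fin r ⊕ Fin s → Matrix (Fin d) (Fin d) ℂ}

theorem rookObservable_isHermitian (h : IsClifford γ) (p : Fin r × Fin s) :
    (rookObservable γ p).IsHermitian := by
  rw [IsHermitian, rookObservable, conjTranspose_smul, conjTranspose_mul, (h.isHermitian _).eq,
    (h.isHermitian _).eq, h.anticommute (.inr p.2) (.inl p.1) (by simp)]
  simp

theorem rookObservable_mul (h : IsClifford γ) (p q : Fin r × Fin s) :
    rookObservable γ p * rookObservable γ q
      = γ (.inl p.1) * γ (.inl q.1) * (γ (.inr p.2) * γ (.inr q.2)) := by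
  rw [rookObservable, rookObservable, smul_mul_smul_comm, Complex.I_mul_I, neg_one_smul, mul_assoc,
    ← mul_assoc (γ (.inr p.2)), h.anticommute (.inr p.2) (.inl q.1) (by simp), neg_mul, mul_neg,
    neg_neg, mul_assoc, mul_assoc]

theorem rookObservable_mul_self (h : IsClifford γ) (p : Fin r × Fin s) :
    rookObservable γ p * rookObservable γ p = 1 := by
  rw [rookObservable_mul h, h.mul_self, h.mul_self, mul_one]

/-- Swapping two observables costs one sign for each coordinate in which their indices differ, so
they anticommute exactly when a single coordinate differs. -/
theorem rookObservable_isRealisation (hd : 0 < d) (h : IsClifford γ) :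
    IsRealisation (rookGraph r s) (rookObservable γ) := by
  have : Nonempty (Fin d) := ⟨⟨0, hd⟩⟩
  have hanti : ∀ p q, (rookGraph r s).Adj p q →
      rookObservable γ p * rookObservable γ q = -(rookObservable γ q * rookObservable γ p) := by
    rintro ⟨i, j⟩ ⟨k, l⟩ hadj
    rw [rookGraph, SimpleGraph.boxProd_adj] at hadj
    rw [rookObservable_mul h, rookObservable_mul h]
    rcases hadj with ⟨hik, hjl⟩ | ⟨hjl, hik⟩
    · obtain rfl : j = l := hjl
      rw [h.anticommute (.inl i) (.inl k) (by simpa using hik), neg_mul]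
    · obtain rfl : i = k := hik
      rw [h.anticommute (.inr j) (.inr l) (by simpa using hjl), mul_neg]
  have hcomm : ∀ p q, ¬ (rookGraph r s).Adj p q →
      rookObservable γ p * rookObservable γ q = rookObservable γ q * rookObservable γ p := by
    rintro ⟨i, j⟩ ⟨k, l⟩ hadj
    rw [rookGraph, SimpleGraph.boxProd_adj] at hadj
    rw [rookObservable_mul h, rookObservable_mul h]
    by_cases hik : i = k
    · subst hik
      have hjl : j = l := by simpa using hadj
      rw [hjl]
    · have hjl : j ≠ l := by simpa [hik] using hadj
      rw [h.anticommute (.inl i) (.inl k) (by simpa using hik),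
        h.anticommute (.inr j) (.inr l) (by simpa using hjl), neg_mul_neg]
  refine ⟨fun p => ⟨rookObservable_isHermitian h p, rookObservable_mul_self h p⟩,
    fun p q => ⟨hanti p q, fun hpq => ?_⟩, hcomm⟩
  by_contra hadj
  -- Commuting and anticommuting at once would make the product zero, although it is a product of
  -- involutions on a nonzero space.
  have h0 : rookObservable γ q * rookObservable γ p = 0 := by
    have h2 : (2 : ℂ) • (rookObservable γ q * rookObservable γ p) = 0 := by
      rw [two_smul]
      exact eq_neg_iff_add_eq_zero.mp ((hcomm p q hadj).symm.trans hpq)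
    exact (smul_eq_zero.mp h2).resolve_left two_ne_zero
  have h1 : rookObservable γ p * (rookObservable γ p * rookObservable γ q) * rookObservable γ q
      = 1 := by
    rw [← mul_assoc, rookObservable_mul_self h, one_mul, rookObservable_mul_self h]
  rw [hcomm p q hadj, h0] at h1
  simp at h1

/-- A linear combination of the observables in one row. -/
noncomputable def rowObservable (γ : Fin r ⊕ Fin s → Matrix (Fin d) (Fin d) ℂ) (i : Fin r)
    (b : Fin s → ℂ) : Matrix (Fin d) (Fin d) ℂ :=
  ∑ j, b j • rookObservable γ (i, j)

theorem rowObservable_mul (h : IsClifford γ) (i k : Fin r) (b b' : Fin s → ℂ) :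
    rowObservable γ i b * rowObservable γ k b' = γ (.inl i) * γ (.inl k) *
      ((∑ j, b j • γ (.inr j)) * ∑ j, b' j • γ (.inr j)) := by
  rw [rowObservable, rowObservable, Finset.sum_mul_sum, Finset.sum_mul_sum]
  simp only [smul_mul_assoc, rookObservable_mul h, Finset.mul_sum, mul_smul_comm]

theorem anticommutator_sum (h : IsClifford γ) (b b' : Fin s → ℂ) :
    (∑ j, b j • γ (.inr j)) * (∑ j, b' j • γ (.inr j))
      + (∑ j, b' j • γ (.inr j)) * (∑ j, b j • γ (.inr j)) = (2 * ∑ j, b j * b' j) • 1 := by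
  simp only [Finset.sum_mul_sum, smul_mul_smul_comm]
  rw [Finset.sum_comm (f := fun i j => (b' i * b j) • (γ (.inr i) * γ (.inr j))),
    ← Finset.sum_add_distrib, Finset.mul_sum, Finset.sum_smul]
  refine Finset.sum_congr rfl fun i _ => ?_
  rw [← Finset.sum_add_distrib, Finset.sum_eq_single i]
  · rw [h.mul_self, ← add_smul]; congr 1; ring
  · intro j _ hj
    rw [h.anticommute (.inr i) (.inr j) (by simpa using hj.symm), mul_comm (b' j)]
    simp
  · simp

theorem rowObservable_mul_self (h : IsClifford γ) (i : Fin r) (b : Fin s → ℂ) :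
    rowObservable γ i b * rowObservable γ i b = (∑ j, b j * b j) • 1 := by
  have h2 := anticommutator_sum h b b
  rw [← two_smul ℂ, mul_smul] at h2
  rw [rowObservable_mul h, h.mul_self, one_mul]
  exact smul_right_injective _ (two_ne_zero (α := ℂ)) h2

theorem rowObservable_commutator (h : IsClifford γ) {i k : Fin r} (hik : i ≠ k)
    (b b' : Fin s → ℂ) :
    rowObservable γ i b * rowObservable γ k b' - rowObservable γ k b' * rowObservable γ i b
      = (2 * ∑ j, b j * b' j) • (γ (.inl i) * γ (.inl k)) := by
  rw [rowObservable_mul h, rowObservable_mul h,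
    h.anticommute (.inl k) (.inl i) (by simpa using hik.symm), neg_mul, sub_neg_eq_add, ← mul_add,
    anticommutator_sum h, mul_smul_comm, mul_one]

theorem rowObservable_isHermitian (h : IsClifford γ) (i : Fin r) {b : Fin s → ℂ}
    (hb : ∀ j, star (b j) = b j) : (rowObservable γ i b).IsHermitian := by
  simp only [IsHermitian, rowObservable, conjTranspose_sum, conjTranspose_smul, hb,
    (rookObservable_isHermitian h _).eq]

end

/-! ### The upper bound and its equality case. -/

section

variable {d : ℕ}

/-- `B` is `t` times a projection, so with `E = Xᴴ * X` the trace is the squared Hilbert–Schmidt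
norm of `X * B` divided by `t`. Both claims follow from this. -/
theorem trace_mul_nonneg_of_mul_self_eq {E B : Matrix (Fin d) (Fin d) ℂ} (hE : E.PosSemidef)
    (hB : B.IsHermitian) {t : ℝ} (ht : 0 < t) (hBB : B * B = (t : ℂ) • B) :
    0 ≤ (E * B).trace ∧ ((E * B).trace = 0 → E * B = 0) := by
  obtain ⟨X, rfl⟩ := hE.exists_eq_conjTranspose_mul_self
  have ht' : (t : ℂ) ≠ 0 := by exact_mod_cast ht.ne'
  have key : ((X * B)ᴴ * (X * B)).trace = (t : ℂ) * (Xᴴ * X * B).trace := by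
    have h : Xᴴ * (X * B) * B = (t : ℂ) • (Xᴴ * X * B) := by
      simp only [mul_assoc, hBB, mul_smul_comm]
    rw [conjTranspose_mul, hB.eq, mul_assoc B, trace_mul_comm, h, trace_smul, smul_eq_mul]
  constructor
  · have h := (posSemidef_conjTranspose_mul_self (X * B)).trace_nonneg
    rw [key] at h
    have h2 : (0 : ℂ) ≤ ((t⁻¹ : ℝ) : ℂ) := Complex.zero_le_real.mpr (by positivity)
    have := mul_nonneg h2 h
    rwa [← mul_assoc, Complex.ofReal_inv, inv_mul_cancel₀ ht', one_mul] at this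
  · intro h
    rw [h, mul_zero, trace_conjTranspose_mul_self_eq_zero_iff] at key
    rw [mul_assoc, key, mul_zero]

end

section

variable {r s d : ℕ} {γ : Fin r ⊕ Fin s → Matrix (Fin d) (Fin d) ℂ}

/-- The row `i` of a sign pattern, with complex entries. -/
def signRow (a : Fin r × Fin s → ℤˣ) (i : Fin r) (j : Fin s) : ℂ := ((a (i, j) : ℤ) : ℂ)

theorem star_signRow (a : Fin r × Fin s → ℤˣ) (i : Fin r) (j : Fin s) :
    star (signRow a i j) = signRow a i j := by
  simp [signRow]

theorem sum_signRow_mul_self (a : Fin r × Fin s → ℤˣ) (i : Fin r) :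
    ∑ j, signRow a i j * signRow a i j = (s : ℂ) := by
  simp [signRow, unitsInt_cast_mul_self]

/-- `√s - R`, with `R` the row observable of a sign pattern. -/
noncomputable def rowGap (γ : Fin r ⊕ Fin s → Matrix (Fin d) (Fin d) ℂ)
    (a : Fin r × Fin s → ℤˣ) (i : Fin r) : Matrix (Fin d) (Fin d) ℂ :=
  ((√(s : ℝ) : ℝ) : ℂ) • 1 - rowObservable γ i (signRow a i)

theorem sqrt_natCast_mul_self (s : ℕ) : ((√(s : ℝ) : ℝ) : ℂ) * ((√(s : ℝ) : ℝ) : ℂ) = s := by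
  rw [← Complex.ofReal_mul, Real.mul_self_sqrt (Nat.cast_nonneg s), Complex.ofReal_natCast]

theorem rowGap_isHermitian (h : IsClifford γ) (a : Fin r × Fin s → ℤˣ) (i : Fin r) :
    (rowGap γ a i).IsHermitian := by
  refine IsHermitian.sub ?_ (rowObservable_isHermitian h i (star_signRow a i))
  simp [IsHermitian, conjTranspose_smul]

theorem rowGap_mul_self (h : IsClifford γ) (a : Fin r × Fin s → ℤˣ) (i : Fin r) :
    rowGap γ a i * rowGap γ a i = ((2 * √(s : ℝ) : ℝ) : ℂ) • rowGap γ a i := by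
  rw [rowGap, mul_sub, sub_mul, sub_mul, rowObservable_mul_self h, sum_signRow_mul_self,
    ← sqrt_natCast_mul_self]
  simp only [smul_mul_assoc, mul_smul_comm, one_mul, mul_one, Complex.ofReal_mul,
    Complex.ofReal_ofNat]
  module

theorem rowGap_trace_nonneg (hs : 0 < s) (h : IsClifford γ) {E : Matrix (Fin d) (Fin d) ℂ}
    (hE : E.PosSemidef) (a : Fin r × Fin s → ℤˣ) (i : Fin r) :
    0 ≤ (E * rowGap γ a i).trace ∧ ((E * rowGap γ a i).trace = 0 → E * rowGap γ a i = 0) :=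
  trace_mul_nonneg_of_mul_self_eq hE (rowGap_isHermitian h a i) (by positivity)
    (rowGap_mul_self h a i)

/-- Summing over `a` replaces each sign `a (i, j)` by the marginal `η A_ij`. Every `A_ij` then meets
itself and contributes `η d`, so only the dimensions and `η` remain. -/
theorem sum_rowGap_trace (h : IsClifford γ) {η : ℝ}
    {E : (Fin r × Fin s → ℤˣ) → Matrix (Fin d) (Fin d) ℂ}
    (hE : IsParent (rookObservable γ) η E) :
    ∑ a, ∑ i, (E a * rowGap γ a i).trace
      = ((r * d * √(s : ℝ) * (1 - η * √(s : ℝ)) : ℝ) : ℂ) := by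
  rw [Finset.sum_comm]
  have hi : ∀ i, ∑ a, (E a * rowGap γ a i).trace
      = ((√(s : ℝ) : ℝ) : ℂ) * d - s * (η * d) := by
    intro i
    have h1 : ∑ a, E a * rowGap γ a i = ((√(s : ℝ) : ℝ) : ℂ) • 1
        - ∑ j, (η : ℂ) • (rookObservable γ (i, j) * rookObservable γ (i, j)) := by
      simp only [rowGap, rowObservable, mul_sub, Finset.sum_sub_distrib, mul_smul_comm, mul_one,
        Finset.mul_sum]
      rw [← Finset.smul_sum, hE.2.1, Finset.sum_comm]
      congr 1
      refine Finset.sum_congr rfl fun j _ => ?_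
      rw [← smul_mul_assoc, ← hE.2.2, Finset.sum_mul]
      simp only [smul_mul_assoc]
      rfl
    rw [← trace_sum, h1]
    rw [trace_sub, trace_sum]
    simp only [rookObservable_mul_self h, trace_smul, trace_one,
      Fintype.card_fin, smul_eq_mul, Finset.sum_const, Finset.card_univ, nsmul_eq_mul]
  simp_rw [hi]
  rw [← sqrt_natCast_mul_self s, Finset.sum_const, Finset.card_univ, Fintype.card_fin,
    nsmul_eq_mul]
  push_cast
  ring

theorem IsParent.le_inv_sqrt (hr : 0 < r) (hs : 0 < s) (hd : 0 < d) (h : IsClifford γ) {η : ℝ}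
    {E : (Fin r × Fin s → ℤˣ) → Matrix (Fin d) (Fin d) ℂ}
    (hE : IsParent (rookObservable γ) η E) : η ≤ 1 / √(s : ℝ) := by
  have h1 := sum_rowGap_trace h hE
  have h2 : (0 : ℂ) ≤ ∑ a, ∑ i, (E a * rowGap γ a i).trace :=
    Finset.sum_nonneg fun a _ => Finset.sum_nonneg fun i _ =>
      (rowGap_trace_nonneg hs h (hE.1 a) a i).1
  rw [h1, Complex.zero_le_real] at h2
  have ht : 0 < √(s : ℝ) := by positivity
  have hc : (0 : ℝ) < r * d * √(s : ℝ) := by positivity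
  rw [le_div_iff₀ ht]
  linarith [nonneg_of_mul_nonneg_right h2 hc]

theorem IsParent.exists_isPartialHadamard (hs : 0 < s) (hd : 0 < d) (h : IsClifford γ)
    {E : (Fin r × Fin s → ℤˣ) → Matrix (Fin d) (Fin d) ℂ}
    (hE : IsParent (rookObservable γ) (1 / √(s : ℝ)) E) :
    ∃ C : Matrix (Fin r) (Fin s) ℝ, IsPartialHadamard C := by
  have : Nonempty (Fin d) := ⟨⟨0, hd⟩⟩
  have ht : (0 : ℝ) < √(s : ℝ) := by positivity
  have h1 := sum_rowGap_trace h hE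
  rw [one_div, inv_mul_cancel₀ ht.ne', sub_self, mul_zero, Complex.ofReal_zero,
    Finset.sum_eq_zero_iff_of_nonneg fun a _ => Finset.sum_nonneg fun i _ =>
      (rowGap_trace_nonneg hs h (hE.1 a) a i).1] at h1
  obtain ⟨a, ha⟩ : ∃ a, E a ≠ 0 := by
    by_contra! h0
    have := hE.2.1
    simp [h0] at this
  have h2 := h1 a (Finset.mem_univ a)
  rw [Finset.sum_eq_zero_iff_of_nonneg fun i _ => (rowGap_trace_nonneg hs h (hE.1 a) a i).1] at h2
  have hR : ∀ i, E a * rowObservable γ i (signRow a i) = ((√(s : ℝ) : ℝ) : ℂ) • E a := by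
    intro i
    have h3 := (rowGap_trace_nonneg hs h (hE.1 a) a i).2 (h2 i (Finset.mem_univ i))
    rw [rowGap, mul_sub, mul_smul_comm, mul_one, sub_eq_zero] at h3
    exact h3.symm
  have hortho : ∀ i k, i ≠ k → ∑ j, signRow a i j * signRow a k j = 0 := by
    intro i k hik
    -- `E a` absorbs each row observable as the scalar `√s`, so it kills their commutator.
    have h3 := congrArg (E a * ·) (rowObservable_commutator h hik (signRow a i) (signRow a k))
    simp only [mul_sub, ← mul_assoc, hR, smul_mul_assoc, sub_self, mul_smul_comm] at h3
    -- `c_k c_i` inverts `c_i c_k`, leaving a scalar multiple of `E a ≠ 0`.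
    have h4 := congrArg (· * (γ (.inl k) * γ (.inl i))) h3.symm
    simp only [smul_mul_assoc, zero_mul] at h4
    rw [mul_assoc, mul_assoc, ← mul_assoc (γ (.inl k)), h.mul_self, one_mul, h.mul_self, mul_one]
      at h4
    simpa [ha] using h4
  refine ⟨of fun i j => ((a (i, j) : ℤ) : ℝ), fun i j => ?_, ?_⟩
  · rcases Int.units_eq_one_or (a (i, j)) with h' | h' <;> simp [h']
  · ext i k
    apply Complex.ofReal_injective
    by_cases hik : i = k
    · subst hik
      have := sum_signRow_mul_self a i
      simpa [mul_apply, signRow] using this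
    · have := hortho i k hik
      simpa [mul_apply, signRow, hik] using this

end

/-! ### Optimal measurement from a partial Hadamard matrix. -/

theorem sum_sign_mul_sign {ι : Type*} [Fintype ι] [DecidableEq ι] (j l : ι) :
    ∑ e : ι → ℤˣ, ((e j : ℤ) : ℂ) * ((e l : ℤ) : ℂ)
      = if j = l then (Fintype.card (ι → ℤˣ) : ℂ) else 0 := by
  split_ifs with h
  · subst h
    simp only [unitsInt_cast_mul_self, Finset.sum_const, Finset.card_univ, nsmul_eq_mul, mul_one]
  · have h1 : ∑ e : ι → ℤˣ, ((e j : ℤ) : ℂ) * ((e l : ℤ) : ℂ)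
        = -∑ e : ι → ℤˣ, ((e j : ℤ) : ℂ) * ((e l : ℤ) : ℂ) := by
      rw [← Finset.sum_neg_distrib]
      -- Flipping `e j` alone reverses the sign of every term.
      refine Fintype.sum_equiv (Equiv.mulRight (Pi.mulSingle j (-1))) _ _ fun e => ?_
      simp [Pi.mulSingle_eq_of_ne (Ne.symm h)]
    exact self_eq_neg.mp h1

/-- Relabelling outcomes of a finite measurement. -/
theorem sum_smul_fiberwise {α β M : Type*} [Fintype α] [Fintype β] [DecidableEq β]
    [AddCommMonoid M] [Module ℂ M] (f : α → β) (W : α → M) (g : β → ℂ) :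
    ∑ b, g b • ∑ p with f p = b, W p = ∑ p, g (f p) • W p := by
  rw [← Finset.sum_fiberwise (s := Finset.univ) (g := f)]
  refine Finset.sum_congr rfl fun b _ => ?_
  rw [Finset.smul_sum]
  refine Finset.sum_congr rfl fun p hp => ?_
  rw [(Finset.mem_filter.mp hp).2]

section

variable {r s d : ℕ} {γ : Fin r ⊕ Fin s → Matrix (Fin d) (Fin d) ℂ}

/-- Draw column signs `e` uniformly, measure jointly the commuting involutions with coefficients `C
i j * e j / √s` to get row signs `e'`, and output `e' i * e j * C i j`. Averaging over `e` removes
the cross terms `e j * e l` with `j ≠ l`, leaving `A_ij / √s`. -/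
theorem IsPartialHadamard.exists_isParent (hs : 0 < s) (h : IsClifford γ)
    {C : Matrix (Fin r) (Fin s) ℝ} (hC : IsPartialHadamard C) :
    ∃ F, IsParent (rookObservable γ) (1 / √(s : ℝ)) F := by
  obtain ⟨hC1, hC2⟩ := hC
  have hu : ∀ i j, ∃ u : ℤˣ, ((u : ℤ) : ℂ) = C i j := by
    intro i j
    rcases hC1 i j with h' | h'
    · exact ⟨1, by simp [h']⟩
    · exact ⟨-1, by simp [h']⟩
  choose u hu using hu
  have hs0 : (s : ℂ) ≠ 0 := by exact_mod_cast hs.ne'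
  obtain ⟨t, ht0, ht⟩ : ∃ t : ℝ, t = 1 / √(s : ℝ) ∧ (t : ℂ) * t = 1 / s := by
    refine ⟨_, rfl, ?_⟩
    rw [Complex.ofReal_div, Complex.ofReal_one, div_mul_div_comm, sqrt_natCast_mul_self, one_mul]
  rw [← ht0]
  let b : (Fin s → ℤˣ) → Fin r → Fin s → ℂ := fun e i j =>
    (t : ℂ) * (((u i j : ℤ) : ℂ) * ((e j : ℤ) : ℂ))
  have hbb : ∀ e i k, ∑ j, b e i j * b e k j = if i = k then 1 else 0 := by
    intro e i k
    have h1 := congrArg (fun x : ℝ => (x : ℂ)) (congrFun (congrFun hC2 i) k)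
    have h2 : ∑ j, b e i j * b e k j = (t : ℂ) * t * ∑ j, (C i j : ℂ) * C k j := by
      rw [Finset.mul_sum]
      refine Finset.sum_congr rfl fun j _ => ?_
      rw [← hu, ← hu]
      linear_combination ((t : ℂ) * t * (u i j : ℤ) * (u k j : ℤ)) * unitsInt_cast_mul_self (e j)
    have h3 : ∑ j, (C i j : ℂ) * C k j = if i = k then (s : ℂ) else 0 := by
      simp only [mul_apply, transpose_apply, Complex.ofReal_sum, Complex.ofReal_mul] at h1
      rw [h1]
      split_ifs with hik <;> simp [hik]
    rw [h2, ht, h3]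
    split_ifs <;> simp [hs0]
  have hQ := fun e => exists_joint_of_commute (fun i => rowObservable γ i (b e i))
    (fun i => rowObservable_isHermitian h i fun j => by simp [b])
    (fun i => by rw [rowObservable_mul_self h, hbb, if_pos rfl, one_smul])
    (fun i k => by
      by_cases hik : i = k
      · rw [hik]
      · rw [← sub_eq_zero, rowObservable_commutator h hik, hbb, if_neg hik, mul_zero, zero_smul])
  choose Q hQ0 hQ1 hQR using hQ
  let N : ℂ := Fintype.card (Fin s → ℤˣ)
  have hN : N ≠ 0 := Nat.cast_ne_zero.mpr Fintype.card_ne_zero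
  let f : (Fin s → ℤˣ) × (Fin r → ℤˣ) → (Fin r × Fin s → ℤˣ) := fun p v =>
    p.2 v.1 * (p.1 v.2 * u v.1 v.2)
  let W : (Fin s → ℤˣ) × (Fin r → ℤˣ) → Matrix (Fin d) (Fin d) ℂ := fun p => N⁻¹ • Q p.1 p.2
  refine ⟨fun a => ∑ p with f p = a, W p, fun a => ?_, ?_, ?_⟩
  · refine posSemidef_sum _ fun p _ => (hQ0 _ _).smul ?_
    simp only [N]
    rw [← Complex.ofReal_natCast, ← Complex.ofReal_inv]
    exact Complex.zero_le_real.mpr (by positivity)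
  · have := sum_smul_fiberwise f W fun _ => 1
    simp only [one_smul] at this
    rw [this, Fintype.sum_prod_type]
    simp only [W, ← Finset.smul_sum, hQ1]
    rw [Finset.sum_const, Finset.card_univ, ← Nat.cast_smul_eq_nsmul ℂ, smul_smul,
      inv_mul_cancel₀ hN, one_smul]
  · rintro ⟨i, j⟩
    rw [sum_smul_fiberwise f W fun a => ((a (i, j) : ℤ) : ℂ), Fintype.sum_prod_type]
    have h1 : ∀ e : Fin s → ℤˣ, ∑ e', (((f (e, e') (i, j) : ℤˣ) : ℤ) : ℂ) • W (e, e')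
        = (N⁻¹ * (((e j : ℤ) : ℂ) * ((u i j : ℤ) : ℂ))) • rowObservable γ i (b e i) := by
      intro e
      rw [← hQR, Finset.smul_sum]
      refine Finset.sum_congr rfl fun e' _ => ?_
      simp only [f, W, smul_smul, Units.val_mul, Int.cast_mul]
      congr 1
      ring
    simp only [h1]
    simp only [rowObservable, Finset.smul_sum, smul_smul]
    rw [Finset.sum_comm]
    have h2 : ∀ l, ∑ e : Fin s → ℤˣ, (N⁻¹ * (((e j : ℤ) : ℂ) * ((u i j : ℤ) : ℂ)) * b e i l)
        = if j = l then (t : ℂ) else 0 := by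
      intro l
      have : ∀ e : Fin s → ℤˣ, N⁻¹ * (((e j : ℤ) : ℂ) * ((u i j : ℤ) : ℂ)) * b e i l
          = N⁻¹ * t * (u i j : ℤ) * (u i l : ℤ) * (((e j : ℤ) : ℂ) * ((e l : ℤ) : ℂ)) := by
        intro e
        simp only [b]
        ring
      simp only [this]
      rw [← Finset.mul_sum, sum_sign_mul_sign]
      split_ifs with hjl
      · subst hjl
        change N⁻¹ * t * (u i j : ℤ) * (u i j : ℤ) * N = t
        rw [mul_assoc (N⁻¹ * t), unitsInt_cast_mul_self]
        field_simp
      · rw [mul_zero]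
    simp only [← Finset.sum_smul, h2]
    simp

end

/-! ### Assembly and the one-vertex case. -/

theorem rookGraph_exists_adj {r s : ℕ} (hs : 2 ≤ s) (v : Fin r × Fin s) :
    ∃ w, (rookGraph r s).Adj v w := by
  have : Nontrivial (Fin s) := Fin.nontrivial_iff_two_le.mpr hs
  obtain ⟨j, hj⟩ := exists_ne v.2
  refine ⟨(v.1, j), ?_⟩
  rw [rookGraph, SimpleGraph.boxProd_adj]
  exact Or.inr ⟨hj.symm, rfl⟩

/-- At `η = 1` the trace term disappears, so no tracelessness is needed and the joint spectral
measurement serves as parent. -/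
theorem isGreatest_compatibleNoise_of_commute {d : ℕ} {V : Type*} [Fintype V] [DecidableEq V]
    {A : V → Matrix (Fin d) (Fin d) ℂ} (hA : ∀ v, IsBinaryObservable (A v))
    (hcomm : ∀ v w, A v * A w = A w * A v) : IsGreatest (compatibleNoise A) 1 := by
  refine ⟨⟨by simp, ?_⟩, fun η h => h.1.2⟩
  rw [jointlyMeasurable_binaryEffect_iff]
  obtain ⟨Q, h0, h1, h2⟩ := exists_joint_of_commute A (fun v => (hA v).1) (fun v => (hA v).2) hcomm
  exact ⟨Q, h0, h1, fun v => by simp [h2, noisyObservable]⟩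

theorem incompatibilityRobustness_of_subsingleton {d : ℕ} {V : Type*} [Fintype V] [DecidableEq V]
    [Subsingleton V] {G : SimpleGraph V} (hd : 0 < d) {A : V → Matrix (Fin d) (Fin d) ℂ}
    (hA : IsRealisation G A) : incompatibilityRobustness G = 1 := by
  refine IsGreatest.csSup_eq ⟨⟨d, hd, A, hA, ?_⟩, ?_⟩
  · exact (isGreatest_compatibleNoise_of_commute hA.binary fun v w => by
      rw [Subsingleton.elim v w]).1
  · rintro η ⟨_, _, _, _, h⟩
    exact h.1.2

theorem mainTheorem10 (r s : ℕ) (hr : 1 ≤ r) (hrs : r ≤ s) :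
    (∃ d : ℕ, 0 < d ∧ ∃ A : Fin r × Fin s → Matrix (Fin d) (Fin d) ℂ,
      IsRealisation (rookGraph r s) A) ∧
    (∀ d : ℕ, 0 < d → ∀ A : Fin r × Fin s → Matrix (Fin d) (Fin d) ℂ,
      IsRealisation (rookGraph r s) A →
        IsGreatest (compatibleNoise A) (incompatibilityRobustness (rookGraph r s))) ∧
    incompatibilityRobustness (rookGraph r s) ≤ 1 / Real.sqrt (s : ℝ) ∧
    (incompatibilityRobustness (rookGraph r s) = 1 / Real.sqrt (s : ℝ) ↔
      ∃ C : Matrix (Fin r) (Fin s) ℝ, IsPartialHadamard C) := by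
  obtain ⟨d, hd, g, hg⟩ := exists_isClifford (r + s)
  let γ : Fin r ⊕ Fin s → Matrix (Fin d) (Fin d) ℂ := fun k => g (finSumFinEquiv k)
  have hγ : IsClifford γ := ⟨fun k => hg.isHermitian _, fun k => hg.mul_self _,
    fun k l hkl => hg.anticommute _ _ (finSumFinEquiv.injective.ne hkl)⟩
  have hA := rookObservable_isRealisation hd hγ
  refine ⟨⟨d, hd, _, hA⟩, ?_⟩
  by_cases hs : 2 ≤ s
  · have hG := rookGraph_exists_adj (r := r) hs
    have hmem := isGreatest_incompatibilityRobustness hG hd hA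
    have hmem' := (mem_compatibleNoise_iff (hA.trace_eq_zero hG)).mp hmem.1
    obtain ⟨-, E, hE⟩ := hmem'
    have hle := hE.le_inv_sqrt hr (by omega) hd hγ
    refine ⟨fun d' hd' B hB => isGreatest_incompatibilityRobustness hG hd' hB, hle,
      fun heq => ?_, fun ⟨C, hC⟩ => le_antisymm hle (hmem.2 ?_)⟩
    · rw [heq] at hE
      exact hE.exists_isPartialHadamard (by omega) hd hγ
    · rw [mem_compatibleNoise_iff (hA.trace_eq_zero hG)]
      refine ⟨⟨by positivity, ?_⟩, hC.exists_isParent (by omega) hγ⟩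
      rw [div_le_one (Real.sqrt_pos.mpr (by exact_mod_cast (by omega : 0 < s))),
        Real.one_le_sqrt]
      exact_mod_cast (by omega : 1 ≤ s)
  -- The single vertex has no neighbour, so its observable may have nonzero trace and the transfer
  -- argument is unavailable; here the robustness is `1 = 1 / √1`.
  · obtain rfl : s = 1 := by omega
    obtain rfl : r = 1 := by omega
    have h1 := incompatibilityRobustness_of_subsingleton hd hA
    rw [h1]
    refine ⟨fun d' hd' B hB => isGreatest_compatibleNoise_of_commute hB.binary fun v w => by
      rw [Subsingleton.elim v w], by simp, fun _ => ⟨1, fun i j => ?_, by simp⟩, fun _ => by simp⟩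
    rw [Subsingleton.elim i j]
    simp
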